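/- Let $G$ be a finite simple graph with vertex set $V$ (adjacent letters are the distinguishable ones). Let $P$ be a probability distribution on $V\times V$ with equal marginals $P_1=P_2$, put $W(b|a)=P(a,b)/P_1(a)$ for $a\in\operatorname{supp}P_1$, and assume that the transition matrix $W$ is irreducible on the state space $\operatorname{supp}P_1$. Let $\mu^P$ be the law of the corresponding stationary Markov chain, so that its first $n$ symbols have the distribution $$\mu^P_{12\ldots n}(x_1,\dots,x_n)=P_1(x_1)\prod_{i=1}^{n-1}W(x_{i+1}|x_i)$$ on $V^n$ (read as $0$ if $P_1(x_1)=0$). Let $G^{*n}$ be the $n$-th co-normal power of $G$: its vertex set is $V^n$, and $x,y\in V^n$ are adjacent iff $x_i$ and $y_i$ are adjacent in $G$ for at least one $i$. For $S\subseteq V^n$ let $G^{*n}[S]$ be the induced subgraph, and let $\chi$ be the chromatic number. For a finite graph $K$ and a probability distribution $Q$ on $V(K)$ let $$H(K,Q)=\min_{a}\sum_{v\in V(K)}Q(v)\log\frac1{a_v}$$ be the graph entropy, where $a$ ranges over the vertex packing polytope of $K$ (the convex hull of the indicator vectors of the independent sets of $K$), with the conventions $0\log\frac10=0$ and $q\log\frac10=+\infty$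 for $q>0$. Logarithms are to base $2$. Then the limit $\lim_{n\to\infty}\frac1n H(G^{*n},\mu^P_{12\ldots n})$ exists, and for every $c\in(0,1)$ the limit on the left-hand side below exists and $$\lim_{n\to\infty}\ \min_{\substack{S\subseteq V^n\\ \mu^P_{12\ldots n}(S)\ge c}}\frac1n\log\chi(G^{*n}[S])=\lim_{n\to\infty}\frac1n H(G^{*n},\mu^P_{12\ldots n}).$$ -/

import Mathlib

open Filter Topology

/-- The `n`-th co-normal (disjunctive, OR) power of a graph: two strings of length `n` are adjacent
iff they are adjacent in at least one coordinate. -/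
def SimpleGraph.conormalPow {V : Type*} (G : SimpleGraph V) (n : ℕ) : SimpleGraph (Fin n → V) where
  Adj x y := ∃ i, G.Adj (x i) (y i)
  symm := ⟨fun _ _ ⟨i, hi⟩ => ⟨i, hi.symm⟩⟩
  loopless := ⟨fun _ ⟨_, hi⟩ => G.irrefl hi⟩

/-- The vertex packing polytope: the convex hull of the indicator vectors of independent sets. -/
def SimpleGraph.vertexPackingPolytope {V : Type*} (G : SimpleGraph V) : Set (V → ℝ) :=
  convexHull ℝ {v | ∃ s : Set V, G.IsIndepSet s ∧ v = s.indicator (fun _ => (1 : ℝ))}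

/-- The graph entropy (in bits) `H(G, P) = min_a ∑ x, P x * log₂ (1 / a x)`, `a` ranging over the
vertex packing polytope. Terms with `P x = 0` count as zero, and points `a` with `a x = 0 < P x`,
where the objective is `+∞`, do not contribute to the minimum. -/
noncomputable def SimpleGraph.graphEntropy {V : Type*} [Fintype V] (G : SimpleGraph V)
    (P : V → ℝ) : ℝ :=
  sInf ((fun a : V → ℝ => ∑ x, P x * Real.logb 2 (1 / a x)) ''
    {a | a ∈ G.vertexPackingPolytope ∧ ∀ x, 0 < P x → 0 < a x})

namespace MarkovSource

variable {V : Type*} [Fintype V]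

/-- The first marginal `P₁(a) = ∑ b, P(a, b)`. -/
def fstMarginal (P : V × V → ℝ) (a : V) : ℝ := ∑ b, P (a, b)

/-- The second marginal `P₂(b) = ∑ a, P(a, b)`. -/
def sndMarginal (P : V × V → ℝ) (b : V) : ℝ := ∑ a, P (a, b)

/-- The transition matrix `W(b|a) = P(a, b) / P₁(a)`, with rows indexed by `a`
(rows outside the support of `P₁` are zero). -/
noncomputable def transition (P : V × V → ℝ) : Matrix V V ℝ :=
  Matrix.of fun a b => P (a, b) / fstMarginal P a

/-- `P` is the joint distribution of two consecutive symbols of an irreducible stationary Markov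
chain: a probability distribution on `V × V` with equal marginals, such that the transition matrix
is irreducible on the state space `supp P₁`. -/
structure IsIrreducibleStationary (P : V × V → ℝ) : Prop where
  nonneg : ∀ p, 0 ≤ P p
  sum_eq_one : ∑ p, P p = 1
  marginals_eq : fstMarginal P = sndMarginal P
  irreducible : ((transition P).submatrix (Subtype.val : {a : V // 0 < fstMarginal P a} → V)
    Subtype.val).IsIrreducible

/-- The distribution of the first `n` symbols of the stationary Markov chain determined by `P`:
the probability of the string `x₁ … xₙ` is `P₁(x₁) W(x₂|x₁) ⋯ W(xₙ|xₙ₋₁)`. -/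
noncomputable def blockDist (P : V × V → ℝ) : (n : ℕ) → (Fin n → V) → ℝ
  | 0, _ => 1
  | n + 1, x => fstMarginal P (x 0) * ∏ i : Fin n, transition P (x i.castSucc) (x i.succ)

theorem IsIrreducibleStationary.fstMarginal_nonneg {P : V × V → ℝ}
    (hP : IsIrreducibleStationary P) (a : V) : 0 ≤ fstMarginal P a :=
  Finset.sum_nonneg fun _ _ => hP.nonneg _

theorem IsIrreducibleStationary.fstMarginal_mul_transition {P : V × V → ℝ}
    (hP : IsIrreducibleStationary P) (a b : V) :
    fstMarginal P a * transition P a b = P (a, b) := by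
  rcases (hP.fstMarginal_nonneg a).eq_or_lt with h | h
  · have h0 : P (a, b) = 0 :=
      (Finset.sum_eq_zero_iff_of_nonneg (fun b _ => hP.nonneg (a, b))).1 h.symm b
        (Finset.mem_univ b)
    simp [← h, h0]
  · simp only [transition, Matrix.of_apply]
    field_simp

/-- The block distributions have total mass one. -/
theorem IsIrreducibleStationary.sum_blockDist {P : V × V → ℝ}
    (hP : IsIrreducibleStationary P) (n : ℕ) : ∑ x, blockDist P n x = 1 := by
  match n with
  | 0 => simp [blockDist]
  | n + 1 =>
    induction n with
    | zero =>
      rw [← (Equiv.funUnique (Fin 1) V).symm.sum_comp]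
      simp only [blockDist, Finset.univ_eq_empty, Finset.prod_empty, mul_one]
      rw [← hP.sum_eq_one, Fintype.sum_prod_type]
      rfl
    | succ n ih =>
      rw [← ih, ← (Fin.consEquiv fun _ : Fin (n + 2) => V).sum_comp, Fintype.sum_prod_type,
        Finset.sum_comm]
      refine Finset.sum_congr rfl fun y _ => ?_
      simp only [blockDist, Fin.consEquiv_apply, Fin.prod_univ_succ (n := n), Fin.cons_zero,
        Fin.castSucc_zero, Fin.cons_succ, ← Fin.succ_castSucc, ← mul_assoc,
        hP.fstMarginal_mul_transition]
      rw [← Finset.sum_mul, hP.marginals_eq]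
      rfl

/-- For `0 < c ≤ 1`: the minimum of `(1 / n) log₂ χ(G^{*n}[S])` over the sets `S` of strings of
length `n` of probability at least `c`. This is a minimum over a finite family of sets, which
contains the set of all strings. -/
noncomputable def minChromaticRate (G : SimpleGraph V) (P : V × V → ℝ) (c : ℝ) (n : ℕ) : ℝ :=
  ⨅ S : {S : Finset (Fin n → V) // c ≤ ∑ x ∈ S, blockDist P n x},
    1 / (n : ℝ) * Real.logb 2
      (((G.conormalPow n).induce (S.1 : Set (Fin n → V))).chromaticNumber.toNat : ℝ)

end MarkovSource

/-!
Write `Hₙ` for the graph entropy of `G^{*n}` under the law `μₙ` of the first `n` letters.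

Everything rests on one family of points of the vertex packing polytopes. Fix a block length `k` and
a near-optimal point `a` for `Hₖ`. Tiling a long string by blocks of length `k`, in each of the `k`
possible phases, and averaging over the phases gives a point `b` of the polytope of `G^{*n}` with
`log (1 / b(x)) ≤ (1 / k) ∑ₜ log (1 / a(xₜ … xₜ₊ₖ₋₁)) + O(1)`, where the sum is over all windows of
`x` (`SimpleGraph.exists_packing_of_block`). Because every window occurs in the sum, a weak law of
large numbers for irreducible chains applies, whether or not the chain is periodic
(`exists_chainExp_centredSum_sq_le`, from the solution of the Poisson equation
`g = h - W h`). Hence `log (1 / b(x))` exceeds `n (Hₖ / k + o(1))` by a negligible amount in mean,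
counting only the positive part of the excess (`IsIrreducibleStationary.exists_sum_posPart_le`).
With `h = inf (Hₖ + 2) / k` this shows `Hₙ / n → h` (`IsIrreducibleStationary.exists_rate`).

For the upper bound on the chromatic number, the strings with `log (1 / b(x)) ≤ n (h + ε)` have
probability tending to one, and the set of these strings is coloured by repeatedly choosing the
independent set that covers most of what is left; this uses `2 ^ (n (h + ε)) O(n)` colours
(`SimpleGraph.colorable_induce_of_le`, `IsIrreducibleStationary.minChromaticRate_le`).

For the lower bound, let `μₙ(S) ≥ c` and let `χ` be the chromatic number of `G^{*n}[S]`. The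
average of the colour classes is a polytope point equal to `1 / χ` on `S`. Its midpoint with `b` has
mean cost at most `μₙ(S) log χ + (1 - μₙ(S)) n h + o(n)`, while no point has mean cost below
`n h - 2`. Therefore `log χ ≥ n h - o(n)`, for every `c > 0`
(`IsIrreducibleStationary.le_logb_chromaticNumber`): a bound on the mean cost becomes a bound for
sets of any positive probability because `b` does not exceed `n h` by much off `S` either.
-/

/-! ### The vertex packing polytope -/

namespace SimpleGraph

section Polytope

variable {X : Type*} (K : SimpleGraph X)

theorem convex_vertexPackingPolytope : Convex ℝ K.vertexPackingPolytope :=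
  convex_convexHull ℝ _

theorem indicator_mem_vertexPackingPolytope {s : Set X} (hs : K.IsIndepSet s) :
    s.indicator (fun _ => (1 : ℝ)) ∈ K.vertexPackingPolytope :=
  subset_convexHull ℝ _ ⟨s, hs, rfl⟩

theorem vertexPackingPolytope_subset_of_convex {C : Set (X → ℝ)} (hC : Convex ℝ C)
    (h : ∀ s : Set X, K.IsIndepSet s → s.indicator (fun _ => (1 : ℝ)) ∈ C) :
    K.vertexPackingPolytope ⊆ C := by
  refine convexHull_min ?_ hC
  rintro _ ⟨s, hs, rfl⟩
  exact h s hs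

theorem vertexPackingPolytope_subset_Icc : K.vertexPackingPolytope ⊆ Set.Icc 0 1 := by
  refine K.vertexPackingPolytope_subset_of_convex (convex_Icc 0 1) fun s _ => ⟨?_, ?_⟩
  · exact fun x => Set.indicator_nonneg (fun _ _ => zero_le_one) x
  · exact fun x => Set.indicator_le_self' (fun _ _ => zero_le_one) x

/-- The point constantly equal to `1 / |X|` is the average of the indicators of singletons. -/
theorem const_inv_card_mem_vertexPackingPolytope [Fintype X] [Nonempty X] :
    (fun _ => (Fintype.card X : ℝ)⁻¹) ∈ K.vertexPackingPolytope := by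
  classical
  have h := K.convex_vertexPackingPolytope.sum_mem (t := Finset.univ)
    (w := fun _ : X => (Fintype.card X : ℝ)⁻¹)
    (z := fun x => ({x} : Set X).indicator (fun _ => (1 : ℝ)))
    (fun _ _ => by positivity) (by simp)
    (fun x _ => K.indicator_mem_vertexPackingPolytope (Set.pairwise_singleton _ _))
  convert h using 1
  ext y
  simp [Finset.sum_apply, Pi.single_apply]

/-- A proper colouring of an induced subgraph with `N` colours yields the polytope point
`N⁻¹ ∑ᵢ 1_{Cᵢ}`, where the `Cᵢ` are the colour classes. -/
theorem exists_mem_vertexPackingPolytope_of_colorable {S : Set X} {N : ℕ} (hN : 0 < N)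
    (h : (K.induce S).Colorable N) :
    ∃ p ∈ K.vertexPackingPolytope, ∀ x ∈ S, p x = (N : ℝ)⁻¹ := by
  classical
  obtain ⟨col⟩ := h
  let A : Fin N → Set X := fun i => {x | ∃ hx : x ∈ S, col ⟨x, hx⟩ = i}
  have hA : ∀ i, K.IsIndepSet (A i) := by
    rintro i x ⟨hx, hxi⟩ y ⟨hy, hyi⟩ _ hadj
    exact col.valid (v := ⟨x, hx⟩) (w := ⟨y, hy⟩) hadj (hxi.trans hyi.symm)
  refine ⟨∑ i : Fin N, (N : ℝ)⁻¹ • (A i).indicator (fun _ => (1 : ℝ)),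
    K.convex_vertexPackingPolytope.sum_mem (fun _ _ => by positivity) ?_
      (fun i _ => K.indicator_mem_vertexPackingPolytope (hA i)), fun x hx => ?_⟩
  · simp [hN.ne']
  · simp [Finset.sum_apply, Set.indicator_apply, A, hx]

/-- Averaging over `S` in the convex combination `p` shows that some independent set covers at
least the fraction `δ` of `S`. -/
theorem exists_isIndepSet_le_card [DecidableEq X] {p : X → ℝ} (hp : p ∈ K.vertexPackingPolytope)
    {S : Finset X} {δ : ℝ} (h : ∀ x ∈ S, δ ≤ p x) :
    ∃ s : Finset X, s ⊆ S ∧ K.IsIndepSet (s : Set X) ∧ δ * S.card ≤ s.card := by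
  classical
  by_contra! hcon
  have hsub : K.vertexPackingPolytope ⊆ {q | ∑ x ∈ S, q x < δ * S.card} := by
    refine K.vertexPackingPolytope_subset_of_convex ?_ fun s hs => ?_
    · have : IsLinearMap ℝ fun q : X → ℝ => ∑ x ∈ S, q x :=
        ⟨fun _ _ => Finset.sum_add_distrib, fun _ _ => (Finset.mul_sum ..).symm⟩
      exact convex_halfSpace_lt this _
    · have := hcon (S.filter (· ∈ s)) (Finset.filter_subset _ _)
        (hs.mono fun x hx => (Finset.mem_filter.1 hx).2)
      simpa [Set.indicator_apply, Finset.sum_ite] using this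
  have h1 : ∑ x ∈ S, p x < δ * S.card := hsub hp
  have h2 : ∑ _x ∈ S, δ ≤ ∑ x ∈ S, p x := Finset.sum_le_sum h
  rw [Finset.sum_const, nsmul_eq_mul] at h2
  linarith

/-- Greedy covering: repeatedly choosing an independent set that covers the fraction `δ` of what is
left colours all but `(1 - δ) ^ M * |S|` vertices of `S` with `M` colours. -/
theorem exists_partial_coloring [DecidableEq X] {p : X → ℝ} (hp : p ∈ K.vertexPackingPolytope)
    {S : Finset X} {δ : ℝ} (hδ : δ ≤ 1) (h : ∀ x ∈ S, δ ≤ p x) (M : ℕ) :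
    ∃ T ⊆ S, (T.card : ℝ) ≤ (1 - δ) ^ M * S.card ∧
      ∃ col : X → ℕ, (∀ x ∈ S \ T, col x < M) ∧
        ∀ x ∈ S \ T, ∀ y ∈ S \ T, K.Adj x y → col x ≠ col y := by
  induction M with
  | zero => exact ⟨S, subset_rfl, by simp, fun _ => 0, by simp, by simp⟩
  | succ M ih =>
    obtain ⟨T, hTS, hT, col, hcol, hproper⟩ := ih
    obtain ⟨s, hsT, hs, hcard⟩ :=
      K.exists_isIndepSet_le_card hp (S := T) fun x hx => h x (hTS hx)
    refine ⟨T \ s, Finset.sdiff_subset.trans hTS, ?_, fun x => if x ∈ s then M else col x, ?_, ?_⟩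
    · rw [Finset.cast_card_sdiff hsT, pow_succ]
      nlinarith
    · intro x hx
      by_cases hxs : x ∈ s
      · simp [hxs]
      · have := hcol x (by grind)
        simp only [hxs, if_false]
        lia
    · intro x hx y hy hadj
      by_cases hxs : x ∈ s <;> by_cases hys : y ∈ s
      · exact absurd hadj (hs hxs hys hadj.ne)
      · have := hcol y (by grind)
        simp only [hxs, hys, if_true, if_false]
        lia
      · have := hcol x (by grind)
        simp only [hxs, hys, if_true, if_false]
        lia
      · simpa only [hxs, hys, if_false] using hproper x (by grind) y (by grind) hadj

/-- If a polytope point is at least `δ` on `S`, then `K[S]` can be coloured with any number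
`M > log |S| / δ` of colours. -/
theorem colorable_induce_of_le {p : X → ℝ} (hp : p ∈ K.vertexPackingPolytope)
    {S : Finset X} {δ : ℝ} (hδ1 : δ ≤ 1) (h : ∀ x ∈ S, δ ≤ p x) {M : ℕ}
    (hM : Real.log S.card < δ * M) : (K.induce (S : Set X)).Colorable M := by
  classical
  obtain ⟨T, hTS, hT, col, hcol, hproper⟩ := K.exists_partial_coloring hp hδ1 h M
  have hT0 : T = ∅ := by
    rcases S.eq_empty_or_nonempty with rfl | hS
    · simpa using hTS
    by_contra hne
    have h1 : (1 : ℝ) ≤ T.card := by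
      exact_mod_cast Finset.card_pos.2 (Finset.nonempty_iff_ne_empty.2 hne)
    have hS0 : (0 : ℝ) < S.card := by exact_mod_cast Finset.card_pos.2 hS
    have h2 : (1 - δ) ^ M ≤ Real.exp (-(δ * M)) := by
      have := pow_le_pow_left₀ (sub_nonneg.2 hδ1) (Real.one_sub_le_exp_neg δ) M
      rwa [← Real.exp_nat_mul, show (M : ℝ) * -δ = -(δ * M) by ring] at this
    have h3 : Real.exp (-(δ * M)) * S.card < 1 := by
      nth_rw 1 [← Real.exp_log hS0]
      rw [← Real.exp_add, Real.exp_lt_one_iff]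
      linarith
    have := mul_le_mul_of_nonneg_right h2 hS0.le
    linarith
  subst hT0
  simp only [Finset.sdiff_empty] at hcol hproper
  exact ⟨Coloring.mk (fun x => ⟨col x, hcol x x.2⟩)
    fun {x y} hadj heq => hproper x x.2 y y.2 hadj (Fin.mk.inj_iff.1 heq)⟩

end Polytope

section GraphEntropy

variable {X : Type*} [Fintype X] (K : SimpleGraph X) {Q : X → ℝ}

theorem sum_mul_logb_one_div_nonneg (hQ : ∀ x, 0 ≤ Q x) {p : X → ℝ}
    (hp : p ∈ K.vertexPackingPolytope) : 0 ≤ ∑ x, Q x * Real.logb 2 (1 / p x) := by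
  refine Finset.sum_nonneg fun x _ => mul_nonneg (hQ x) ?_
  have h := K.vertexPackingPolytope_subset_Icc hp
  rw [one_div, Real.logb_inv, neg_nonneg]
  exact Real.logb_nonpos one_lt_two (h.1 x) (h.2 x)

theorem graphEntropy_nonneg (hQ : ∀ x, 0 ≤ Q x) : 0 ≤ K.graphEntropy Q := by
  refine Real.sInf_nonneg ?_
  rintro _ ⟨p, ⟨hp, _⟩, rfl⟩
  exact K.sum_mul_logb_one_div_nonneg hQ hp

theorem graphEntropy_le (hQ : ∀ x, 0 ≤ Q x) {p : X → ℝ} (hp : p ∈ K.vertexPackingPolytope)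
    (hpos : ∀ x, 0 < p x) : K.graphEntropy Q ≤ ∑ x, Q x * Real.logb 2 (1 / p x) := by
  refine csInf_le ⟨0, ?_⟩ ⟨p, ⟨hp, fun x _ => hpos x⟩, rfl⟩
  rintro _ ⟨p, ⟨hp, _⟩, rfl⟩
  exact K.sum_mul_logb_one_div_nonneg hQ hp

/-- Halving a point of the polytope costs one bit. -/
theorem _root_.Real.logb_one_div_midpoint_le {x y : ℝ} (hx : 0 < x) (hy : 0 ≤ y) :
    Real.logb 2 (1 / (1 / 2 * x + 1 / 2 * y)) ≤ 1 + Real.logb 2 (1 / x) := by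
  have h : Real.logb 2 (1 / (1 / 2 * x + 1 / 2 * y)) ≤ Real.logb 2 (2 * (1 / x)) := by
    refine Real.logb_le_logb_of_le one_lt_two (by positivity) ?_
    rw [mul_one_div, div_le_div_iff₀ (by positivity) hx]
    linarith
  rwa [Real.logb_mul (by norm_num) (by positivity), Real.logb_self_eq_one one_lt_two] at h

theorem midpoint_mem_vertexPackingPolytope {X : Type*} (K : SimpleGraph X) {p q : X → ℝ}
    (hp : p ∈ K.vertexPackingPolytope) (hq : q ∈ K.vertexPackingPolytope) :
    (fun x => 1 / 2 * p x + 1 / 2 * q x) ∈ K.vertexPackingPolytope :=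
  K.convex_vertexPackingPolytope hp hq (by norm_num) (by norm_num) (by norm_num)

/-- Up to two bits, the graph entropy is attained at a polytope point without zero coordinates. -/
theorem exists_pos_sum_le_graphEntropy_add [Nonempty X] (hQ : ∀ x, 0 ≤ Q x) (hQ1 : ∑ x, Q x = 1) :
    ∃ p ∈ K.vertexPackingPolytope, (∀ x, 0 < p x) ∧
      ∑ x, Q x * Real.logb 2 (1 / p x) ≤ K.graphEntropy Q + 2 := by
  have hu := K.const_inv_card_mem_vertexPackingPolytope
  have hc : (0 : ℝ) < (Fintype.card X : ℝ)⁻¹ := by positivity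
  obtain ⟨_, ⟨p, ⟨hp, hp0⟩, rfl⟩, hlt⟩ := exists_lt_of_csInf_lt
    (s := (fun a : X → ℝ => ∑ x, Q x * Real.logb 2 (1 / a x)) ''
      {a | a ∈ K.vertexPackingPolytope ∧ ∀ x, 0 < Q x → 0 < a x})
    ⟨_, _, ⟨hu, fun _ _ => hc⟩, rfl⟩ (lt_add_one (K.graphEntropy Q))
  have hpnn := (K.vertexPackingPolytope_subset_Icc hp).1
  refine ⟨_, K.midpoint_mem_vertexPackingPolytope hp hu, fun x => ?_, ?_⟩
  · have : 0 ≤ p x := hpnn x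
    positivity
  · have : ∑ x, Q x * Real.logb 2 (1 / (1 / 2 * p x + 1 / 2 * (Fintype.card X : ℝ)⁻¹)) ≤
        ∑ x, Q x * (1 + Real.logb 2 (1 / p x)) := by
      refine Finset.sum_le_sum fun x _ => ?_
      rcases (hQ x).eq_or_lt with h | h
      · simp [← h]
      · exact mul_le_mul_of_nonneg_left (Real.logb_one_div_midpoint_le (hp0 x h) hc.le) h.le
    simp only [mul_add, Finset.sum_add_distrib, mul_one, hQ1] at this
    linarith

end GraphEntropy

end SimpleGraph

/-! ### Products of polytope points on co-normal powers -/

namespace SimpleGraph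

variable {V : Type*} (G : SimpleGraph V)

/-- `p ⊗ q` lies in the polytope of `G^{*(m+n)}`, since a product of independent sets is
independent in the co-normal product. -/
theorem mul_mem_vertexPackingPolytope_conormalPow {m n : ℕ} {p : (Fin m → V) → ℝ}
    {q : (Fin n → V) → ℝ} (hp : p ∈ (G.conormalPow m).vertexPackingPolytope)
    (hq : q ∈ (G.conormalPow n).vertexPackingPolytope) :
    (fun z : Fin (m + n) → V => p (fun i => z (Fin.castAdd n i)) * q (fun i => z (Fin.natAdd m i)))
      ∈ (G.conormalPow (m + n)).vertexPackingPolytope := by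
  have hconv := (G.conormalPow (m + n)).convex_vertexPackingPolytope
  refine (G.conormalPow m).vertexPackingPolytope_subset_of_convex
    (C := {p | (fun z : Fin (m + n) → V => p (fun i => z (Fin.castAdd n i)) *
      q (fun i => z (Fin.natAdd m i))) ∈ (G.conormalPow (m + n)).vertexPackingPolytope})
    ?_ (fun s hs => ?_) hp
  · intro p₁ h₁ p₂ h₂ a b ha hb hab
    rw [Set.mem_ofPred_eq]
    convert hconv h₁ h₂ ha hb hab using 1
    ext z
    simp only [Pi.add_apply, Pi.smul_apply, smul_eq_mul]
    ring
  refine (G.conormalPow n).vertexPackingPolytope_subset_of_convex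
    (C := {q | (fun z : Fin (m + n) → V =>
      s.indicator (fun _ => (1 : ℝ)) (fun i => z (Fin.castAdd n i)) *
      q (fun i => z (Fin.natAdd m i))) ∈ (G.conormalPow (m + n)).vertexPackingPolytope})
    ?_ (fun t ht => ?_) hq
  · intro p₁ h₁ p₂ h₂ a b ha hb hab
    rw [Set.mem_ofPred_eq]
    convert hconv h₁ h₂ ha hb hab using 1
    ext z
    simp only [Pi.add_apply, Pi.smul_apply, smul_eq_mul]
    ring
  · have hst : (G.conormalPow (m + n)).IsIndepSet
        {z | (fun i => z (Fin.castAdd n i)) ∈ s ∧ (fun i => z (Fin.natAdd m i)) ∈ t} := by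
      rintro x ⟨hxs, hxt⟩ y ⟨hys, hyt⟩ _ ⟨i, hi⟩
      induction i using Fin.addCases with
      | left i =>
        have hadj : (G.conormalPow m).Adj (fun i => x (Fin.castAdd n i))
          (fun i => y (Fin.castAdd n i)) := ⟨i, hi⟩
        exact hs hxs hys hadj.ne hadj
      | right i =>
        have hadj : (G.conormalPow n).Adj (fun i => x (Fin.natAdd m i))
          (fun i => y (Fin.natAdd m i)) := ⟨i, hi⟩
        exact ht hxt hyt hadj.ne hadj
    rw [Set.mem_ofPred_eq]
    convert (G.conormalPow (m + n)).indicator_mem_vertexPackingPolytope hst using 1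
    ext z
    by_cases h1 : (fun i => z (Fin.castAdd n i)) ∈ s <;>
    by_cases h2 : (fun i => z (Fin.natAdd m i)) ∈ t <;>
    simp [h1, h2]

/-- `φ`, a function of infinite strings, is a point of the vertex packing polytope of `G^{*n}`
evaluated at the first `n` letters. Infinite strings make shifts and products of points of
different lengths free of casts between the types `Fin n → V`. -/
def IsPacking (n : ℕ) (φ : (ℕ → V) → ℝ) : Prop :=
  ∃ p ∈ (G.conormalPow n).vertexPackingPolytope, ∀ x : ℕ → V, φ x = p fun i => x i

variable {G}

theorem IsPacking.mul_shift {m n : ℕ} {φ ψ : (ℕ → V) → ℝ} (hφ : G.IsPacking m φ)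
    (hψ : G.IsPacking n ψ) : G.IsPacking (m + n) fun x => φ x * ψ fun i => x (i + m) := by
  obtain ⟨p, hp, hφp⟩ := hφ
  obtain ⟨q, hq, hψq⟩ := hψ
  refine ⟨_, G.mul_mem_vertexPackingPolytope_conormalPow hp hq, fun x => ?_⟩
  simp [hφp, hψq, add_comm]

variable (G) in
theorem isPacking_const [Fintype V] [Nonempty V] (n : ℕ) :
    G.IsPacking n fun _ => ((Fintype.card V : ℝ) ^ n)⁻¹ :=
  ⟨_, (G.conormalPow n).const_inv_card_mem_vertexPackingPolytope, fun _ => by simp⟩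

/-- The product of `a` over `q` consecutive blocks of length `k`. -/
theorem IsPacking.prod_blocks {k : ℕ} {a : (ℕ → V) → ℝ} (ha : G.IsPacking k a) (q : ℕ) :
    G.IsPacking (q * k) fun x => ∏ i ∈ Finset.range q, a fun l => x (l + i * k) := by
  induction q with
  | zero =>
    refine ⟨Set.univ.indicator fun _ => 1,
      (G.conormalPow (0 * k)).indicator_mem_vertexPackingPolytope ?_, fun x => by simp⟩
    rintro x - y - hxy
    refine absurd (funext fun i => ?_) hxy
    have := i.2
    lia
  | succ q ih =>
    rw [Nat.succ_mul]
    convert ih.mul_shift ha using 2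
    rw [Finset.prod_range_succ]

/-- The average over `j < k` of polytope points. -/
theorem IsPacking.average {n k : ℕ} (hk : 0 < k) {φ : ℕ → (ℕ → V) → ℝ}
    (h : ∀ j < k, G.IsPacking n (φ j)) :
    G.IsPacking n fun x => ∑ j ∈ Finset.range k, (k : ℝ)⁻¹ * φ j x := by
  choose! p hp hφ using h
  refine ⟨_, (G.conormalPow n).convex_vertexPackingPolytope.sum_mem (t := Finset.range k)
    (w := fun _ => (k : ℝ)⁻¹) (z := p) (fun _ _ => by positivity) ?_
    (fun j hj => hp j (Finset.mem_range.1 hj)), fun x => ?_⟩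
  · simp [hk.ne']
  · simp only [Finset.sum_apply, Pi.smul_apply, smul_eq_mul]
    exact Finset.sum_congr rfl fun j hj => by rw [hφ j (Finset.mem_range.1 hj)]

end SimpleGraph

/-! ### Expectations along a Markov chain -/

namespace MarkovSource

section Chain

variable {S : Type*} [Fintype S]

/-- The infinite string `a x₀ x₁ x₂ …`. -/
def consSeq {S : Type*} (a : S) (x : ℕ → S) : ℕ → S
  | 0 => a
  | i + 1 => x i

/-- The expectation `F ↦ E[F(X) | X₀ = a]` for the Markov chain with transition matrix `W` run for
`N` steps. So that `F` can be a function of infinite strings, the path `X₀ … X_N` is extended by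
repeating its last state; only functions of the first `N + 1` letters are meaningful arguments. -/
noncomputable def chainExp (W : Matrix S S ℝ) : ℕ → S → ((ℕ → S) → ℝ) →ₗ[ℝ] ℝ
  | 0, a => LinearMap.proj fun _ => a
  | N + 1, a => ∑ b, W a b • (chainExp W N b).comp (LinearMap.funLeft ℝ ℝ (consSeq a))

variable {W : Matrix S S ℝ}

theorem chainExp_zero (a : S) (F : (ℕ → S) → ℝ) : chainExp W 0 a F = F fun _ => a := rfl

theorem chainExp_succ (N : ℕ) (a : S) (F : (ℕ → S) → ℝ) :
    chainExp W (N + 1) a F = ∑ b, W a b * chainExp W N b fun x => F (consSeq a x) := by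
  simp only [chainExp, LinearMap.sum_apply, LinearMap.smul_apply, LinearMap.comp_apply,
    smul_eq_mul]
  rfl

/-- One step of the Markov property. -/
theorem chainExp_succ_shift (N : ℕ) (a : S) (F : (ℕ → S) → ℝ) :
    chainExp W (N + 1) a (fun x => F fun i => x (i + 1)) = ∑ b, W a b * chainExp W N b F :=
  chainExp_succ N a _

theorem chainExp_nonneg (hW : ∀ a b, 0 ≤ W a b) (N : ℕ) (a : S) {F : (ℕ → S) → ℝ}
    (hF : ∀ x, 0 ≤ F x) : 0 ≤ chainExp W N a F := by
  induction N generalizing a F with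
  | zero => exact hF _
  | succ N ih =>
    rw [chainExp_succ]
    exact Finset.sum_nonneg fun b _ => mul_nonneg (hW a b) (ih b fun x => hF _)

theorem chainExp_mono (hW : ∀ a b, 0 ≤ W a b) (N : ℕ) (a : S) {F F' : (ℕ → S) → ℝ}
    (h : ∀ x, F x ≤ F' x) : chainExp W N a F ≤ chainExp W N a F' := by
  have := chainExp_nonneg hW N a (F := F' - F) fun x => sub_nonneg.2 (h x)
  rwa [map_sub, sub_nonneg] at this

theorem chainExp_const (hW1 : ∀ a, ∑ b, W a b = 1) (N : ℕ) (a : S) (r : ℝ) :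
    chainExp W N a (fun _ => r) = r := by
  induction N generalizing a with
  | zero => rfl
  | succ N ih =>
    rw [chainExp_succ]
    simp_rw [ih, ← Finset.sum_mul, hW1, one_mul]

theorem abs_chainExp_le (hW : ∀ a b, 0 ≤ W a b) (hW1 : ∀ a, ∑ b, W a b = 1) (N : ℕ) (a : S)
    {F : (ℕ → S) → ℝ} {r : ℝ} (h : ∀ x, |F x| ≤ r) : |chainExp W N a F| ≤ r := by
  rw [abs_le]
  constructor
  · rw [← chainExp_const hW1 N a (-r)]
    exact chainExp_mono hW N a fun x => (abs_le.1 (h x)).1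
  · rw [← chainExp_const hW1 N a r]
    exact chainExp_mono hW N a fun x => (abs_le.1 (h x)).2

theorem dependsOn_comp_consSeq {S : Type*} {k : ℕ} {F : (ℕ → S) → ℝ} (hF : DependsOn F (Set.Iio (k + 1)))
    (a : S) : DependsOn (fun x => F (consSeq a x)) (Set.Iio k) := by
  refine fun x y hxy => hF fun i hi => ?_
  cases i with
  | zero => rfl
  | succ i => exact hxy i (by simpa using hi)

/-- The horizon is irrelevant to functions of the letters before it. -/
theorem chainExp_succ_eq (hW1 : ∀ a, ∑ b, W a b = 1) {N : ℕ} {F : (ℕ → S) → ℝ}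
    (hF : DependsOn F (Set.Iio (N + 1))) (a : S) : chainExp W (N + 1) a F = chainExp W N a F := by
  induction N generalizing a F with
  | zero =>
    have h : ∀ b, F (consSeq a fun _ => b) = F fun _ => a := fun b => hF fun i hi => by
      obtain rfl : i = 0 := by simpa using hi
      rfl
    rw [chainExp_succ]
    simp_rw [chainExp_zero, h, ← Finset.sum_mul, hW1, one_mul]
  | succ N ih =>
    rw [chainExp_succ, chainExp_succ N]
    exact Finset.sum_congr rfl fun b _ => by rw [ih (dependsOn_comp_consSeq hF a)]

theorem chainExp_eq_of_le (hW1 : ∀ a, ∑ b, W a b = 1) {k N : ℕ} {F : (ℕ → S) → ℝ}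
    (hF : DependsOn F (Set.Iio (k + 1))) (hkN : k ≤ N) (a : S) :
    chainExp W N a F = chainExp W k a F := by
  induction N, hkN using Nat.le_induction with
  | base => rfl
  | succ N hN ih =>
    rw [chainExp_succ_eq hW1 (hF.mono (Set.Iio_subset_Iio (by lia))), ih]

theorem abs_sum_mul_le (hW : ∀ a b, 0 ≤ W a b) (hW1 : ∀ a, ∑ b, W a b = 1) (a : S) {u : S → ℝ}
    {r : ℝ} (h : ∀ b, |u b| ≤ r) : |∑ b, W a b * u b| ≤ r := by
  calc |∑ b, W a b * u b| ≤ ∑ b, W a b * r := by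
        refine (Finset.abs_sum_le_sum_abs _ _).trans (Finset.sum_le_sum fun b _ => ?_)
        rw [abs_mul, abs_of_nonneg (hW a b)]
        exact mul_le_mul_of_nonneg_left (h b) (hW a b)
    _ = r := by rw [← Finset.sum_mul, hW1, one_mul]

/-! ### The Poisson equation and the weak law of large numbers -/

/-- Maximum principle: a harmonic function of an irreducible stochastic matrix is constant. -/
theorem eq_of_harmonic (hirr : W.IsIrreducible) (hW1 : ∀ a, ∑ b, W a b = 1) {u : S → ℝ}
    (hu : ∀ a, u a = ∑ b, W a b * u b) (a b : S) : u a = u b := by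
  classical
  have hne : Nonempty S := ⟨a⟩
  obtain ⟨i, hi⟩ := Finite.exists_max u
  suffices h : ∀ j, u j = u i by rw [h a, h b]
  intro j
  obtain ⟨k, -, hk⟩ := (Matrix.isIrreducible_iff_exists_pow_pos hirr.nonneg).1 hirr i j
  have hnn : ∀ k a b, 0 ≤ (W ^ k) a b := fun k a b => Matrix.pow_apply_nonneg hirr.nonneg k a b
  have hsum : ∀ k a, ∑ b, (W ^ k) a b = 1 := by
    intro k
    induction k with
    | zero => simp [Matrix.one_apply]
    | succ k ih =>
      intro a
      simp_rw [pow_succ, Matrix.mul_apply]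
      rw [Finset.sum_comm]
      simp_rw [← Finset.mul_sum, hW1, mul_one, ih]
  have hpow : ∀ k, (W ^ k).mulVec u = u := by
    intro k
    induction k with
    | zero => simp
    | succ k ih =>
      rw [pow_succ, ← Matrix.mulVec_mulVec, show W.mulVec u = u from funext fun a => (hu a).symm, ih]
  have h0 : ∑ b, (W ^ k) i b * (u i - u b) = 0 := by
    have := congrFun (hpow k) i
    simp only [Matrix.mulVec, dotProduct] at this
    simp_rw [mul_sub, Finset.sum_sub_distrib, ← Finset.sum_mul, hsum, this]
    ring
  have := (Finset.sum_eq_zero_iff_of_nonneg fun b _ =>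
    mul_nonneg (hnn k i b) (sub_nonneg.2 (hi b))).1 h0 j (Finset.mem_univ j)
  rcases mul_eq_zero.1 this with h | h
  · exact absurd h hk.ne'
  · linarith

/-- The Poisson equation `g = h - W h` is solvable for every `g` of mean zero under the stationary
distribution `π`: the operator `u ↦ u - W u + (π · u) 1` is injective, hence surjective. -/
theorem exists_poisson (hirr : W.IsIrreducible) (hW1 : ∀ a, ∑ b, W a b = 1) {π : S → ℝ}
    (hπ1 : ∑ a, π a = 1) (hπ : ∀ b, ∑ a, π a * W a b = π b) {g : S → ℝ}
    (hg : ∑ a, π a * g a = 0) : ∃ h : S → ℝ, ∀ a, g a = h a - ∑ b, W a b * h b := by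
  have hπW : ∀ u : S → ℝ, ∑ a, π a * ∑ b, W a b * u b = ∑ b, π b * u b := by
    intro u
    simp_rw [Finset.mul_sum]
    rw [Finset.sum_comm]
    simp_rw [← mul_assoc, ← Finset.sum_mul, hπ]
  let T : (S → ℝ) →ₗ[ℝ] (S → ℝ) :=
    LinearMap.id - W.mulVecLin + (LinearMap.pi fun _ => ∑ a, π a • LinearMap.proj a)
  have hT : ∀ u a, T u a = u a - ∑ b, W a b * u b + ∑ b, π b * u b := by
    intro u a
    simp [T, Matrix.mulVec, dotProduct, LinearMap.sum_apply]
  have hπT : ∀ u, ∑ a, π a * T u a = ∑ b, π b * u b := by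
    intro u
    simp_rw [hT, mul_add, mul_sub, Finset.sum_add_distrib, Finset.sum_sub_distrib, hπW,
      ← Finset.sum_mul, hπ1]
    ring
  have hinj : Function.Injective T := by
    rw [injective_iff_map_eq_zero]
    intro u hu
    have h0 : ∑ b, π b * u b = 0 := by rw [← hπT, hu]; simp
    have hharm : ∀ a, u a = ∑ b, W a b * u b := by
      intro a
      have := hT u a
      rw [hu, h0] at this
      simp only [Pi.zero_apply] at this
      linarith
    ext a
    have hconst := eq_of_harmonic hirr hW1 hharm
    simp_rw [fun b => hconst b a, ← Finset.sum_mul, hπ1, one_mul] at h0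
    exact h0
  obtain ⟨h, hh⟩ := LinearMap.injective_iff_surjective.1 hinj g
  refine ⟨h, fun a => ?_⟩
  have h0 : ∑ b, π b * h b = 0 := by rw [← hπT, hh, hg]
  rw [← hh, hT, h0, add_zero]

/-- The centred sums `∑ t < n, (f(x_t x_{t+1} …) - m)`. -/
def centredSum {S : Type*} (f : (ℕ → S) → ℝ) (m : ℝ) (n : ℕ) (x : ℕ → S) : ℝ :=
  ∑ t ∈ Finset.range n, ((f fun i => x (i + t)) - m)

theorem centredSum_zero {S : Type*} (f : (ℕ → S) → ℝ) (m : ℝ) (x : ℕ → S) : centredSum f m 0 x = 0 := by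
  simp [centredSum]

theorem centredSum_succ {S : Type*} (f : (ℕ → S) → ℝ) (m : ℝ) (n : ℕ) (x : ℕ → S) :
    centredSum f m (n + 1) x = (f x - m) + centredSum f m n fun i => x (i + 1) := by
  rw [centredSum, Finset.sum_range_succ', add_comm]
  simp only [centredSum, add_zero, add_right_inj]
  exact Finset.sum_congr rfl fun t _ => by simp [add_assoc]

/-- By the Poisson equation, the expectations of the centred sums are bounded. -/
theorem exists_abs_chainExp_centredSum_le (hirr : W.IsIrreducible) (hW1 : ∀ a, ∑ b, W a b = 1)
    {π : S → ℝ} (hπ1 : ∑ a, π a = 1) (hπ : ∀ b, ∑ a, π a * W a b = π b) {k : ℕ}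
    {f : (ℕ → S) → ℝ} (hf : DependsOn f (Set.Iio (k + 1))) {m : ℝ}
    (hm : ∑ a, π a * chainExp W k a f = m) :
    ∃ C : ℝ, ∀ n N a, n + k ≤ N → |chainExp W N a (centredSum f m n)| ≤ C := by
  have hne : Nonempty S := by
    by_contra h
    rw [not_nonempty_iff] at h
    simp at hπ1
  obtain ⟨h, hh⟩ := exists_poisson hirr hW1 hπ1 hπ (g := fun a => chainExp W k a f - m) (by
    simp_rw [mul_sub, Finset.sum_sub_distrib, ← Finset.sum_mul, hπ1, hm]
    ring)
  obtain ⟨i, hi⟩ := Finite.exists_max fun a => |h a|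
  have key : ∀ n N a, n + k ≤ N → |chainExp W N a (centredSum f m n) - h a| ≤ |h i| := by
    intro n
    induction n with
    | zero =>
      intro N a _
      rw [show centredSum f m 0 = 0 from funext fun x => centredSum_zero f m x, map_zero, zero_sub,
        abs_neg]
      exact hi a
    | succ n ih =>
      rintro (_ | N) a hN
      · lia
      rw [show centredSum f m (n + 1) = (f - fun _ => m) +
        fun x => centredSum f m n fun i => x (i + 1) from funext fun x => centredSum_succ f m n x,
        map_add, map_sub, chainExp_const hW1, chainExp_succ_shift,
        chainExp_eq_of_le hW1 hf (by lia), hh a]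
      have := abs_sum_mul_le hirr.nonneg hW1 a fun b => ih N b (by lia)
      simp_rw [mul_sub, Finset.sum_sub_distrib] at this
      convert this using 2
      ring
  refine ⟨|h i| + |h i|, fun n N a hN => ?_⟩
  have h1 := key n N a hN
  have h2 := hi a
  have h3 := abs_add_le (chainExp W N a (centredSum f m n) - h a) (h a)
  rw [sub_add_cancel] at h3
  linarith

/-- Correlations between a function of the first `j` letters and the centred sums are bounded. -/
theorem exists_abs_chainExp_mul_centredSum_le (hirr : W.IsIrreducible)
    (hW1 : ∀ a, ∑ b, W a b = 1) {π : S → ℝ} (hπ1 : ∑ a, π a = 1)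
    (hπ : ∀ b, ∑ a, π a * W a b = π b) {k : ℕ} {f : (ℕ → S) → ℝ}
    (hf : DependsOn f (Set.Iio (k + 1))) {m : ℝ} (hm : ∑ a, π a * chainExp W k a f = m) {M : ℝ}
    (hM : 0 ≤ M) (hfM : ∀ x, |f x - m| ≤ M) (j : ℕ) :
    ∃ C : ℝ, 0 ≤ C ∧ ∀ g : (ℕ → S) → ℝ, DependsOn g (Set.Iio j) → (∀ x, |g x| ≤ M) →
      ∀ n N a, n + k ≤ N → |chainExp W N a (g * centredSum f m n)| ≤ C := by
  induction j with
  | zero =>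
    obtain ⟨C, hC⟩ := exists_abs_chainExp_centredSum_le hirr hW1 hπ1 hπ hf hm
    refine ⟨M * |C|, by positivity, fun g hg hgM n N a hN => ?_⟩
    have hgc : g * centredSum f m n = g (fun _ => a) • centredSum f m n := by
      ext x
      simp only [Pi.mul_apply, Pi.smul_apply, smul_eq_mul]
      rw [hg (y := fun _ => a) (by simp)]
    rw [hgc, map_smul, smul_eq_mul, abs_mul]
    exact mul_le_mul (hgM _) ((hC n N a hN).trans (le_abs_self C)) (abs_nonneg _) hM
  | succ j ih =>
    obtain ⟨C, hC0, hC⟩ := ih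
    refine ⟨M * M + C, by positivity, fun g hg hgM n N a hN => ?_⟩
    cases n with
    | zero =>
      rw [show centredSum f m 0 = 0 from funext fun x => centredSum_zero f m x, mul_zero, map_zero,
        abs_zero]
      positivity
    | succ n =>
      obtain _ | N := N
      · lia
      have hsplit : g * centredSum f m (n + 1) = (fun x => g x * (f x - m)) +
          fun x => g x * centredSum f m n fun i => x (i + 1) := by
        ext x
        simp only [Pi.mul_apply, Pi.add_apply, centredSum_succ]
        ring
      rw [hsplit, map_add]
      refine (abs_add_le _ _).trans (add_le_add ?_ ?_)
      · refine abs_chainExp_le hirr.nonneg hW1 _ _ fun x => ?_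
        rw [abs_mul]
        exact mul_le_mul (hgM x) (hfM x) (abs_nonneg _) hM
      · rw [chainExp_succ]
        exact abs_sum_mul_le hirr.nonneg hW1 a fun b =>
          hC _ (dependsOn_comp_consSeq hg a) (fun x => hgM _) n N b (by lia)

/-- The second moments of the centred sums grow at most linearly. -/
theorem exists_chainExp_centredSum_sq_le (hirr : W.IsIrreducible) (hW1 : ∀ a, ∑ b, W a b = 1)
    {π : S → ℝ} (hπ1 : ∑ a, π a = 1) (hπ : ∀ b, ∑ a, π a * W a b = π b) {k : ℕ}
    {f : (ℕ → S) → ℝ} (hf : DependsOn f (Set.Iio (k + 1))) {m : ℝ}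
    (hm : ∑ a, π a * chainExp W k a f = m) {M : ℝ} (hfM : ∀ x, |f x - m| ≤ M) :
    ∃ C : ℝ, 0 ≤ C ∧ ∀ n N a, n + k ≤ N →
      chainExp W N a (fun x => centredSum f m n x ^ 2) ≤ C * n := by
  obtain hS | hS := isEmpty_or_nonempty S
  · exact ⟨0, le_rfl, fun _ _ a => isEmptyElim a⟩
  have hM : 0 ≤ M := (abs_nonneg _).trans (hfM fun _ => Classical.arbitrary S)
  obtain ⟨C, hC0, hC⟩ :=
    exists_abs_chainExp_mul_centredSum_le hirr hW1 hπ1 hπ hf hm hM hfM k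
  refine ⟨M ^ 2 + 2 * C, by positivity, fun n => ?_⟩
  induction n with
  | zero =>
    intro N a _
    simp only [centredSum_zero]
    rw [chainExp_const hW1]
    simp
  | succ n ih =>
    rintro (_ | N) a hN
    · lia
    have hsplit : (fun x => centredSum f m (n + 1) x ^ 2) = (fun x => (f x - m) ^ 2) +
        ((2 : ℝ) • (fun x => (f x - m) * centredSum f m n fun i => x (i + 1)) +
          fun x => (centredSum f m n fun i => x (i + 1)) ^ 2) := by
      ext x
      simp only [Pi.smul_apply, Pi.add_apply, centredSum_succ, smul_eq_mul]
      ring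
    have h1 : chainExp W (N + 1) a (fun x => (f x - m) ^ 2) ≤ M ^ 2 := by
      refine (le_abs_self _).trans (abs_chainExp_le hirr.nonneg hW1 _ _ fun x => ?_)
      rw [abs_pow]
      exact pow_le_pow_left₀ (abs_nonneg _) (hfM x) 2
    have h2 : chainExp W (N + 1) a
        (fun x => (f x - m) * centredSum f m n fun i => x (i + 1)) ≤ C := by
      rw [chainExp_succ]
      refine (le_abs_self _).trans (abs_sum_mul_le hirr.nonneg hW1 a fun b =>
        hC (fun x => f (consSeq a x) - m) (fun x y hxy => ?_) (fun x => hfM _) n N b (by lia))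
      exact congrArg (· - m) (dependsOn_comp_consSeq hf a hxy)
    have h3 : chainExp W (N + 1) a (fun x => (centredSum f m n fun i => x (i + 1)) ^ 2) ≤
        (M ^ 2 + 2 * C) * n := by
      rw [chainExp_succ_shift N a fun x => centredSum f m n x ^ 2]
      calc _ ≤ ∑ b, W a b * ((M ^ 2 + 2 * C) * n) := Finset.sum_le_sum fun b _ =>
            mul_le_mul_of_nonneg_left (ih N b (by lia)) (hirr.nonneg a b)
        _ = _ := by rw [← Finset.sum_mul, hW1, one_mul]
    rw [hsplit, map_add, map_add, map_smul, smul_eq_mul]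
    push_cast
    linarith

end Chain

end MarkovSource

/-! ### Block distributions as expectations along the chain -/

namespace MarkovSource

section Block

variable {V : Type*}

/-- A string of length `N + 1` extended to an infinite string by repeating its last letter. -/
def extendSeq {N : ℕ} (x : Fin (N + 1) → V) : ℕ → V :=
  fun i => x ⟨min i N, Nat.lt_succ_of_le (min_le_right i N)⟩

theorem extendSeq_val {N : ℕ} (x : Fin (N + 1) → V) : (fun i : Fin (N + 1) => extendSeq x i) = x := by
  ext i
  simp [extendSeq, Nat.le_of_lt_succ i.2]

theorem dependsOn_extendSeq {N : ℕ} {F : (ℕ → V) → ℝ} (hF : DependsOn F (Set.Iio (N + 1)))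
    (s : ℕ → V) : F (extendSeq fun i : Fin (N + 1) => s i) = F s :=
  hF fun i hi => by simp [extendSeq, Nat.le_of_lt_succ hi]

theorem dependsOn_centredSum {k n N : ℕ} {f : (ℕ → V) → ℝ} (hf : DependsOn f (Set.Iio (k + 1)))
    (m : ℝ) (h : n + k ≤ N) : DependsOn (centredSum f m n) (Set.Iio (N + 1)) := by
  refine fun x y hxy => Finset.sum_congr rfl fun t ht => congrArg (· - m) (hf fun i hi => hxy _ ?_)
  have := Finset.mem_range.1 ht
  simp only [Set.mem_Iio] at hi ⊢
  lia

variable [Fintype V] {P : V × V → ℝ}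

/-- The chain expectation as a sum over paths. -/
theorem sum_path_eq_chainExp (W : Matrix V V ℝ) (N : ℕ) (a : V) (F : (Fin (N + 1) → V) → ℝ) :
    ∑ x : Fin N → V, (∏ i : Fin N, W ((Fin.cons a x : Fin (N + 1) → V) i.castSucc)
        ((Fin.cons a x : Fin (N + 1) → V) i.succ)) * F (Fin.cons a x) =
      chainExp W N a fun s => F fun i => s i := by
  induction N generalizing a with
  | zero =>
    rw [chainExp_zero, Fintype.sum_unique]
    simp only [Finset.univ_eq_empty, Finset.prod_empty, one_mul]
    congr 1
    ext i
    cases i using Fin.cases with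
    | zero => rfl
    | succ i => exact i.elim0
  | succ N ih =>
    rw [chainExp_succ, ← (Fin.consEquiv fun _ : Fin (N + 1) => V).sum_comp,
      Fintype.sum_prod_type]
    refine Finset.sum_congr rfl fun b _ => ?_
    have hF : (fun s : ℕ → V => F fun i => consSeq a s i) =
        fun s => F (Fin.cons a fun i : Fin (N + 1) => s i) := by
      ext s
      congr 1
      ext i
      cases i using Fin.cases <;> rfl
    rw [hF, ← ih b fun z => F (Fin.cons a z), Finset.mul_sum]
    refine Finset.sum_congr rfl fun y _ => ?_
    simp only [Fin.consEquiv_apply, Fin.prod_univ_succ (n := N), Fin.cons_zero,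
      Fin.castSucc_zero, Fin.cons_succ, ← Fin.succ_castSucc, mul_assoc]
    rfl

theorem IsIrreducibleStationary.blockDist_nonneg (hP : IsIrreducibleStationary P) (n : ℕ)
    (x : Fin n → V) : 0 ≤ blockDist P n x := by
  cases n with
  | zero => exact zero_le_one
  | succ n =>
    exact mul_nonneg (hP.fstMarginal_nonneg _) (Finset.prod_nonneg fun i _ =>
      div_nonneg (hP.nonneg _) (hP.fstMarginal_nonneg _))

theorem IsIrreducibleStationary.nonempty (hP : IsIrreducibleStationary P) : Nonempty V := by
  by_contra h
  rw [not_nonempty_iff] at h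
  simpa using hP.sum_eq_one

/-- The chain never leaves the support of the stationary distribution. -/
theorem IsIrreducibleStationary.transition_eq_zero (hP : IsIrreducibleStationary P) (a : V) {b : V}
    (hb : ¬ 0 < fstMarginal P b) : transition P a b = 0 := by
  have h0 : sndMarginal P b = 0 := by
    rw [← hP.marginals_eq]
    exact le_antisymm (not_lt.1 hb) (hP.fstMarginal_nonneg b)
  have : P (a, b) = 0 :=
    (Finset.sum_eq_zero_iff_of_nonneg fun a _ => hP.nonneg (a, b)).1 h0 a (Finset.mem_univ a)
  simp [transition, this]

/-- The transition matrix restricted to the support of the stationary distribution. -/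
noncomputable def supportTransition (P : V × V → ℝ) :
    Matrix {a : V // 0 < fstMarginal P a} {a : V // 0 < fstMarginal P a} ℝ :=
  (transition P).submatrix Subtype.val Subtype.val

noncomputable instance fintypeSupport (P : V × V → ℝ) : Fintype {a : V // 0 < fstMarginal P a} :=
  Fintype.ofFinite _

theorem sum_support {u : V → ℝ} (hu : ∀ a, ¬ 0 < fstMarginal P a → u a = 0) :
    ∑ a : {a : V // 0 < fstMarginal P a}, u a = ∑ a, u a := by
  classical
  rw [← Finset.sum_subset (Finset.subset_univ (Finset.univ.filter fun a => 0 < fstMarginal P a))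
    fun a _ ha => hu a (by simpa using ha)]
  exact (Finset.sum_subtype _ (by simp) u).symm

theorem IsIrreducibleStationary.sum_supportTransition (hP : IsIrreducibleStationary P)
    (a : {a : V // 0 < fstMarginal P a}) : ∑ b, supportTransition P a b = 1 := by
  simp only [supportTransition, Matrix.submatrix_apply]
  rw [sum_support (u := transition P a) fun b hb => hP.transition_eq_zero a hb]
  simp only [transition, Matrix.of_apply, ← Finset.sum_div]
  exact div_self a.2.ne'

theorem IsIrreducibleStationary.sum_support_fstMarginal (hP : IsIrreducibleStationary P) :
    ∑ a : {a : V // 0 < fstMarginal P a}, fstMarginal P a = 1 := by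
  rw [sum_support (u := fstMarginal P) fun a ha =>
    le_antisymm (not_lt.1 ha) (hP.fstMarginal_nonneg a), ← hP.sum_eq_one, Fintype.sum_prod_type]
  rfl

theorem IsIrreducibleStationary.sum_support_mul_transition (hP : IsIrreducibleStationary P)
    (b : {a : V // 0 < fstMarginal P a}) :
    ∑ a : {a : V // 0 < fstMarginal P a}, fstMarginal P a * supportTransition P a b =
      fstMarginal P b := by
  simp only [supportTransition, Matrix.submatrix_apply, hP.fstMarginal_mul_transition]
  rw [sum_support (u := fun a => P (a, b)), congrFun hP.marginals_eq]
  · rfl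
  · intro a ha
    rw [← hP.fstMarginal_mul_transition, le_antisymm (not_lt.1 ha) (hP.fstMarginal_nonneg a),
      zero_mul]

theorem IsIrreducibleStationary.chainExp_transition (hP : IsIrreducibleStationary P) (N : ℕ)
    (a : {a : V // 0 < fstMarginal P a}) (F : (ℕ → V) → ℝ) :
    chainExp (transition P) N a F =
      chainExp (supportTransition P) N a fun s => F fun i => s i := by
  induction N generalizing a F with
  | zero => rfl
  | succ N ih =>
    rw [chainExp_succ, chainExp_succ, ← sum_support (P := P) fun b hb => by
      rw [hP.transition_eq_zero a hb, zero_mul]]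
    refine Finset.sum_congr rfl fun b _ => ?_
    rw [ih]
    congr 3
    ext s
    congr 1
    ext i
    cases i <;> rfl

/-- The law `blockDist P (N + 1)` is the stationary chain run for `N` steps. -/
theorem IsIrreducibleStationary.sum_blockDist_mul (hP : IsIrreducibleStationary P) {N : ℕ}
    {F : (ℕ → V) → ℝ} (hF : DependsOn F (Set.Iio (N + 1))) :
    ∑ x, blockDist P (N + 1) x * F (extendSeq x) =
      ∑ a : {a : V // 0 < fstMarginal P a}, fstMarginal P a *
        chainExp (supportTransition P) N a fun s => F fun i => s i := by
  simp_rw [← hP.chainExp_transition]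
  rw [sum_support (u := fun a => fstMarginal P a * chainExp (transition P) N a F) fun a ha => by
      rw [le_antisymm (not_lt.1 ha) (hP.fstMarginal_nonneg a), zero_mul],
    ← (Fin.consEquiv fun _ : Fin (N + 1) => V).sum_comp, Fintype.sum_prod_type]
  refine Finset.sum_congr rfl fun a _ => ?_
  have := sum_path_eq_chainExp (transition P) N a fun z => F (extendSeq z)
  simp_rw [dependsOn_extendSeq hF] at this
  rw [← this, Finset.mul_sum]
  simp only [Fin.consEquiv_apply, blockDist, Fin.cons_zero, mul_assoc]
  rfl

/-- The weak law of large numbers, in mean square, for the sums `∑ t < n, f(x_t … x_{t+k})` along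
the stationary chain. -/
theorem IsIrreducibleStationary.exists_sum_blockDist_mul_sq_le (hP : IsIrreducibleStationary P)
    {k : ℕ} {f : (ℕ → V) → ℝ} (hf : DependsOn f (Set.Iio (k + 1))) {m : ℝ}
    (hm : ∑ x, blockDist P (k + 1) x * f (extendSeq x) = m) :
    ∃ C : ℝ, 0 ≤ C ∧ ∀ n N, n + k ≤ N →
      ∑ x, blockDist P (N + 1) x * centredSum f m n (extendSeq x) ^ 2 ≤ C * n := by
  rw [hP.sum_blockDist_mul hf] at hm
  obtain ⟨C, hC0, hC⟩ := exists_chainExp_centredSum_sq_le (W := supportTransition P)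
    hP.irreducible hP.sum_supportTransition hP.sum_support_fstMarginal
    hP.sum_support_mul_transition (k := k) (f := fun s => f fun i => s i)
    (fun x y hxy => hf fun i hi => congrArg Subtype.val (hxy i hi)) hm
    (M := ∑ x : Fin (k + 1) → V, |f (extendSeq x) - m|) (fun s => by
      rw [← dependsOn_extendSeq hf]
      exact Finset.single_le_sum (f := fun x : Fin (k + 1) → V => |f (extendSeq x) - m|)
        (fun _ _ => abs_nonneg _) (Finset.mem_univ _))
  refine ⟨C, hC0, fun n N hN => ?_⟩
  rw [hP.sum_blockDist_mul (F := fun s => centredSum f m n s ^ 2) fun x y hxy =>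
    congrArg (· ^ 2) (dependsOn_centredSum hf m hN hxy)]
  calc _ ≤ ∑ a : {a : V // 0 < fstMarginal P a}, fstMarginal P a * (C * n) :=
        Finset.sum_le_sum fun a _ => mul_le_mul_of_nonneg_left (hC n N a hN) a.2.le
    _ = C * n := by rw [← Finset.sum_mul, hP.sum_support_fstMarginal, one_mul]

end Block

end MarkovSource

/-! ### Polytope points adapted to a long block -/

namespace SimpleGraph

theorem _root_.Finset.sum_range_mul_add (q k : ℕ) (u : ℕ → ℝ) :
    ∑ j ∈ Finset.range k, ∑ i ∈ Finset.range q, u (i * k + j) = ∑ t ∈ Finset.range (q * k), u t := by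
  rw [Finset.sum_comm]
  induction q with
  | zero => simp
  | succ q ih => rw [Finset.sum_range_succ, ih, Nat.succ_mul, Finset.sum_range_add]

/-- Concavity of the logarithm: the code length of an average is at most the average code length. -/
theorem _root_.Real.logb_one_div_average_le {k : ℕ} (hk : 0 < k) {u : ℕ → ℝ} (hu : ∀ j, 0 < u j) :
    k * Real.logb 2 (1 / ∑ j ∈ Finset.range k, (k : ℝ)⁻¹ * u j) ≤
      ∑ j ∈ Finset.range k, Real.logb 2 (1 / u j) := by
  have hk' : (0 : ℝ) < k := by exact_mod_cast hk
  have h := strictConcaveOn_log_Ioi.concaveOn.le_map_sum (t := Finset.range k)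
    (w := fun _ => (k : ℝ)⁻¹) (p := u) (fun _ _ => by positivity) (by simp [hk.ne'])
    (fun j _ => hu j)
  simp only [smul_eq_mul, ← Finset.mul_sum] at h
  rw [inv_mul_le_iff₀ hk'] at h
  simp only [one_div, Real.logb_inv, Finset.sum_neg_distrib, ← Finset.mul_sum]
  rw [mul_neg, neg_le_neg_iff]
  simp only [Real.logb, ← Finset.sum_div]
  rw [← mul_div_assoc]
  exact div_le_div_of_nonneg_right h (Real.log_nonneg one_le_two)

variable {V : Type*} [Fintype V] [Nonempty V] {G : SimpleGraph V}

/-- Given a polytope point `α` for blocks of length `k`, tile a string of length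
`n ≥ (q + 1) k` by blocks in the `k` possible phases, padding both ends with uniform points. The
average over the phases costs at most `1 / k` times the sum of the costs of `α` over *all* windows
of length `k`, plus a constant. Averaging over phases is what makes the periodicity of the chain
harmless. -/
theorem exists_packing_of_block {k : ℕ} (hk : 0 < k) {α : (ℕ → V) → ℝ} (hα : G.IsPacking k α)
    (hpos : ∀ s, 0 < α s) {n q : ℕ} (hn : (q + 1) * k ≤ n) (hn' : n ≤ (q + 2) * k) :
    ∃ φ, G.IsPacking n φ ∧ (∀ s, 0 < φ s) ∧ ∀ s, k * Real.logb 2 (1 / φ s) ≤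
      ∑ t ∈ Finset.range (q * k), Real.logb 2 (1 / α fun i => s (i + t)) +
        k * (2 * k * Real.logb 2 (Fintype.card V)) := by
  set c : ℝ := (Fintype.card V : ℝ)
  have hc1 : 1 ≤ c := Nat.one_le_cast.2 Fintype.card_pos
  have hc0 : 0 < c := by linarith
  set φ : ℕ → (ℕ → V) → ℝ := fun j s => (c ^ j)⁻¹ *
    ((∏ i ∈ Finset.range q, α fun l => s (l + i * k + j)) * (c ^ (n - q * k - j))⁻¹) with hφ
  have hφpos : ∀ j s, 0 < φ j s := fun j s => by
    have := Finset.prod_pos (s := Finset.range q) fun i _ => hpos fun l => s (l + i * k + j)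
    positivity
  refine ⟨_, IsPacking.average (φ := φ) hk fun j hj => ?_, fun s => ?_, fun s => ?_⟩
  · have h1 := (G.isPacking_const j).mul_shift
      ((hα.prod_blocks q).mul_shift (G.isPacking_const (n - q * k - j)))
    have h2 : j + (q * k + (n - q * k - j)) = n := by
      have : (q + 1) * k = q * k + k := by ring
      lia
    rwa [h2] at h1
  · exact Finset.sum_pos (fun j _ => mul_pos (by positivity) (hφpos j s)) ⟨0, by simpa using hk⟩
  · refine (Real.logb_one_div_average_le hk fun j => hφpos j s).trans ?_
    rw [← Finset.sum_range_mul_add q k fun t => Real.logb 2 (1 / α fun i => s (i + t))]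
    have hle : ∀ j ∈ Finset.range k, Real.logb 2 (1 / φ j s) ≤
        ∑ i ∈ Finset.range q, Real.logb 2 (1 / α fun l => s (l + (i * k + j))) +
          2 * k * Real.logb 2 c := by
      intro j hj
      have hj := Finset.mem_range.1 hj
      have hprod := Finset.prod_pos (s := Finset.range q) fun i _ => hpos fun l => s (l + i * k + j)
      have hL : 0 ≤ Real.logb 2 c := Real.logb_nonneg one_lt_two hc1
      simp only [hφ, one_div, Real.logb_inv, Finset.sum_neg_distrib]
      rw [Real.logb_mul (by positivity) (by positivity),
        Real.logb_mul (by positivity) (by positivity),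
        Real.logb_prod _ _ fun i _ => (hpos _).ne', Real.logb_inv, Real.logb_inv, Real.logb_pow,
        Real.logb_pow]
      have hlen : (j : ℝ) + ((n - q * k - j : ℕ) : ℝ) ≤ 2 * k := by
        have : j + (n - q * k - j) ≤ 2 * k := by
          have h1 : (q + 1) * k = q * k + k := by ring
          have h2 : (q + 2) * k = q * k + 2 * k := by ring
          lia
        exact_mod_cast this
      simp only [add_assoc]
      nlinarith
    refine (Finset.sum_le_sum hle).trans ?_
    rw [Finset.sum_add_distrib, Finset.sum_const, Finset.card_range, nsmul_eq_mul]

end SimpleGraph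

namespace MarkovSource

open SimpleGraph

variable {V : Type*} [Fintype V] {P : V × V → ℝ}

/-- The block distributions admit polytope points whose cost exceeds the rate `(H_k + 2) / k` only
by a bounded amount in mean, even if savings are not counted. This bound on the positive part is
stronger than a bound on the mean cost, and is where the law of large numbers enters. -/
theorem IsIrreducibleStationary.exists_sum_posPart_le (hP : IsIrreducibleStationary P)
    (G : SimpleGraph V) (k : ℕ) {ε : ℝ} (hε : 0 < ε) :
    ∃ D : ℝ, ∀ n, k + 1 ≤ n → ∃ b ∈ (G.conormalPow n).vertexPackingPolytope, (∀ x, 0 < b x) ∧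
      ∑ x, blockDist P n x * max 0 (Real.logb 2 (1 / b x) -
        n * (((G.conormalPow (k + 1)).graphEntropy (blockDist P (k + 1)) + 2) / ((k + 1 : ℕ) : ℝ)
          + ε)) ≤ D := by
  have hV := hP.nonempty
  set H := (G.conormalPow (k + 1)).graphEntropy (blockDist P (k + 1))
  set K := k + 1 with hK
  have hKpos : 0 < K := Nat.succ_pos k
  have hK0 : (0 : ℝ) < (K : ℕ) := by exact_mod_cast hKpos
  have hK1 : (1 : ℝ) ≤ (K : ℕ) := by exact_mod_cast Nat.succ_pos k
  obtain ⟨a, ha, hapos, hle⟩ := (G.conormalPow K).exists_pos_sum_le_graphEntropy_add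
    (hP.blockDist_nonneg K) (hP.sum_blockDist K)
  set α : (ℕ → V) → ℝ := fun s => a fun i => s i with hα
  have hαpack : G.IsPacking K α := ⟨a, ha, fun s => rfl⟩
  set f : (ℕ → V) → ℝ := fun s => Real.logb 2 (1 / α s) with hf
  have hfdep : DependsOn f (Set.Iio (k + 1)) := fun x y hxy => by
    simp only [hf, hα]
    congr 3
    ext i
    exact hxy i i.2
  have hfa : ∀ x : Fin (k + 1) → V, f (extendSeq x) = Real.logb 2 (1 / a x) := fun x =>
    congrArg (fun y => Real.logb 2 (1 / a y)) (extendSeq_val x)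
  set m := ∑ x, blockDist P (k + 1) x * f (extendSeq x) with hm
  have hmH : m ≤ H + 2 := by
    simp_rw [hm, hfa]
    exact hle
  have hm0 : 0 ≤ m := by
    simp_rw [hm, hfa]
    exact (G.conormalPow K).sum_mul_logb_one_div_nonneg (hP.blockDist_nonneg K) ha
  obtain ⟨C, hC0, hC⟩ := hP.exists_sum_blockDist_mul_sq_le hfdep hm.symm
  set L := Real.logb 2 (Fintype.card V)
  have hL : 0 ≤ L := Real.logb_nonneg one_lt_two (by exact_mod_cast Fintype.card_pos (α := V))
  refine ⟨C / (4 * ε) + 2 * K * L, fun n hn => ?_⟩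
  obtain ⟨q, hq⟩ : ∃ q, n / K = q + 1 :=
    Nat.exists_eq_succ_of_ne_zero (Nat.div_pos hn hKpos).ne'
  have hq1 : (q + 1) * K ≤ n := hq ▸ Nat.div_mul_le_self n K
  have hq2 : n ≤ (q + 2) * K := by
    have h1 := Nat.div_add_mod n K
    have h2 := Nat.mod_lt n hKpos
    rw [hq] at h1
    have h3 : (q + 2) * K = K * (q + 1) + K := by ring
    lia
  obtain ⟨φ, ⟨b, hb, hφb⟩, hφpos, hφ⟩ :=
    exists_packing_of_block hKpos hαpack (fun s => hapos _) hq1 hq2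
  obtain ⟨N, rfl⟩ : ∃ N, n = N + 1 := ⟨n - 1, by lia⟩
  have hbφ : ∀ x : Fin (N + 1) → V, b x = φ (extendSeq x) := fun x => by
    rw [hφb, extendSeq_val]
  refine ⟨b, hb, fun x => hbφ x ▸ hφpos _, ?_⟩
  set Z : (Fin (N + 1) → V) → ℝ := fun x => centredSum f m (q * K) (extendSeq x) with hZ
  have hn0 : (0 : ℝ) < ((N + 1 : ℕ) : ℝ) := by positivity
  have hqn : ((q * K : ℕ) : ℝ) ≤ ((N + 1 : ℕ) : ℝ) := by
    have : q * K ≤ N + 1 := le_trans (Nat.mul_le_mul_right K (Nat.le_succ q)) hq1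
    exact_mod_cast this
  have hpoint : ∀ x, max 0 (Real.logb 2 (1 / b x) -
      (N + 1 : ℕ) * ((H + 2) / (K : ℝ) + ε)) ≤
      Z x ^ 2 * (1 / (4 * ε * (N + 1 : ℕ))) + 2 * K * L := by
    intro x
    refine max_le (by positivity) ?_
    have h1 := hφ (extendSeq x)
    rw [← hbφ] at h1
    have h2 : ∑ t ∈ Finset.range (q * K), Real.logb 2 (1 / α fun i => extendSeq x (i + t)) =
        Z x + (q * K : ℕ) * m := by
      simp [hZ, centredSum, hf]
    rw [h2] at h1
    have h3 : ((q * K : ℕ) : ℝ) * m ≤ (N + 1 : ℕ) * (H + 2) :=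
      mul_le_mul hqn hmH hm0 hn0.le
    have h4 : Real.logb 2 (1 / b x) ≤ |Z x| + (N + 1 : ℕ) * ((H + 2) / K) + 2 * K * L := by
      refine le_of_mul_le_mul_left (h1.trans ?_) hK0
      have h5 : Z x ≤ K * |Z x| := (le_abs_self _).trans (le_mul_of_one_le_left (abs_nonneg _) hK1)
      have h6 : (K : ℝ) * ((N + 1 : ℕ) * ((H + 2) / K)) = (N + 1 : ℕ) * (H + 2) := by
        field_simp
      rw [mul_add (K : ℝ), mul_add (K : ℝ), h6]
      linarith
    have h7 : |Z x| ≤ Z x ^ 2 * (1 / (4 * ε * (N + 1 : ℕ))) + (N + 1 : ℕ) * ε := by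
      have h8 : 0 ≤ (|Z x| - 2 * ((N + 1 : ℕ) * ε)) ^ 2 * (1 / (4 * ε * (N + 1 : ℕ))) := by positivity
      have h9 : (|Z x| - 2 * ((N + 1 : ℕ) * ε)) ^ 2 * (1 / (4 * ε * (N + 1 : ℕ))) =
          |Z x| ^ 2 * (1 / (4 * ε * (N + 1 : ℕ))) - |Z x| + (N + 1 : ℕ) * ε := by
        field_simp
        ring
      rw [h9, sq_abs] at h8
      linarith
    rw [mul_add]
    linarith
  have hsecond := hC (q * K) N (by
    have : (q + 1) * K = q * K + K := by ring
    lia)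
  calc _ ≤ ∑ x, blockDist P (N + 1) x * (Z x ^ 2 * (1 / (4 * ε * (N + 1 : ℕ))) + 2 * K * L) :=
        Finset.sum_le_sum fun x _ =>
          mul_le_mul_of_nonneg_left (hpoint x) (hP.blockDist_nonneg _ x)
    _ = (∑ x, blockDist P (N + 1) x * Z x ^ 2) * (1 / (4 * ε * (N + 1 : ℕ))) + 2 * K * L := by
        simp_rw [mul_add, Finset.sum_add_distrib, ← mul_assoc, ← Finset.sum_mul]
        rw [hP.sum_blockDist, one_mul]
    _ ≤ C * (N + 1 : ℕ) * (1 / (4 * ε * (N + 1 : ℕ))) + 2 * K * L := by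
        gcongr
        exact hsecond.trans (mul_le_mul_of_nonneg_left hqn hC0)
    _ = _ := by
        congr 1
        field_simp

end MarkovSource

/-! ### The rate, and the two bounds on the chromatic number -/

namespace MarkovSource

open SimpleGraph

variable {V : Type*} [Fintype V] {P : V × V → ℝ}

/-- The graph entropy rate `h`, obtained as the infimum of `(H_k + 2) / k`, where the summand `2`
pays for points of the polytope without zero coordinates. -/
theorem IsIrreducibleStationary.exists_rate (hP : IsIrreducibleStationary P) (G : SimpleGraph V) :
    ∃ h : ℝ, 0 ≤ h ∧
      (∀ n : ℕ, 0 < n → n * h ≤ (G.conormalPow n).graphEntropy (blockDist P n) + 2) ∧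
      ∀ ε > 0, ∀ᶠ n : ℕ in atTop, ∃ b ∈ (G.conormalPow n).vertexPackingPolytope, (∀ x, 0 < b x) ∧
        ∑ x, blockDist P n x * max 0 (Real.logb 2 (1 / b x) - n * (h + ε)) ≤ ε * n := by
  set r : ℕ → ℝ := fun k =>
    ((G.conormalPow (k + 1)).graphEntropy (blockDist P (k + 1)) + 2) / ((k + 1 : ℕ) : ℝ) with hr
  have hr0 : ∀ k, 0 ≤ r k := fun k => by
    have := (G.conormalPow (k + 1)).graphEntropy_nonneg (hP.blockDist_nonneg (k + 1))
    positivity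
  have hbdd : BddBelow (Set.range r) := ⟨0, by rintro _ ⟨k, rfl⟩; exact hr0 k⟩
  refine ⟨⨅ k, r k, le_ciInf hr0, fun n hn => ?_, fun ε hε => ?_⟩
  · obtain ⟨k, rfl⟩ := Nat.exists_eq_succ_of_ne_zero hn.ne'
    have h1 : ⨅ k, r k ≤ r k := ciInf_le hbdd k
    rw [hr, le_div_iff₀ (by positivity)] at h1
    rw [mul_comm]
    exact h1
  · obtain ⟨k, hk⟩ := exists_lt_of_ciInf_lt (lt_add_of_pos_right (⨅ k, r k) (half_pos hε))
    obtain ⟨D, hD⟩ := hP.exists_sum_posPart_le G k (half_pos hε)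
    filter_upwards [eventually_ge_atTop (k + 1), eventually_ge_atTop ⌈D / ε⌉₊] with n hn hnD
    obtain ⟨b, hb, hbpos, hle⟩ := hD n hn
    refine ⟨b, hb, hbpos, le_trans (Finset.sum_le_sum fun x _ => ?_) (hle.trans ?_)⟩
    · refine mul_le_mul_of_nonneg_left (max_le_max_left 0 (sub_le_sub_left ?_ _))
        (hP.blockDist_nonneg n x)
      refine mul_le_mul_of_nonneg_left ?_ (Nat.cast_nonneg n)
      change r k + ε / 2 ≤ _
      linarith
    · rw [mul_comm, ← div_le_iff₀ hε]
      exact Nat.ceil_le.1 hnD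

/-- Strong converse. If `S` had few colours, then the average of its colour classes and a point `b`
of near-optimal cost would cost about `log χ` on `S` and, whatever the probability of `S`, at most
`n h` off `S`; as the mean cost is at least `n h - 2`, this forces `log χ ≥ n h - o(n)`. -/
theorem IsIrreducibleStationary.le_logb_chromaticNumber (hP : IsIrreducibleStationary P)
    (G : SimpleGraph V) {h η c : ℝ} {n : ℕ} (hc : 0 < c) (hη : 0 ≤ η)
    (hH : n * h ≤ (G.conormalPow n).graphEntropy (blockDist P n) + 2)
    {b : (Fin n → V) → ℝ} (hb : b ∈ (G.conormalPow n).vertexPackingPolytope) (hbpos : ∀ x, 0 < b x)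
    (hcost : ∑ x, blockDist P n x * max 0 (Real.logb 2 (1 / b x) - n * (h + η)) ≤ η * n)
    {S : Finset (Fin n → V)} (hS : c ≤ ∑ x ∈ S, blockDist P n x) :
    n * h - (3 + 2 * η * n) / c ≤ Real.logb 2
      (((G.conormalPow n).induce (S : Set (Fin n → V))).chromaticNumber.toNat : ℝ) := by
  classical
  set K := G.conormalPow n
  set χ := (K.induce (S : Set (Fin n → V))).chromaticNumber.toNat
  have hcol : (K.induce (S : Set (Fin n → V))).Colorable χ :=
    colorable_chromaticNumber_of_fintype _
  have hSne : S.Nonempty := by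
    rw [Finset.nonempty_iff_ne_empty]
    rintro rfl
    rw [Finset.sum_empty] at hS
    linarith
  obtain ⟨x₀, hx₀⟩ := hSne
  have hχ : 0 < χ := by
    obtain ⟨col⟩ := hcol
    exact (Nat.zero_le _).trans_lt (col ⟨x₀, hx₀⟩).2
  obtain ⟨p, hp, hpS⟩ := K.exists_mem_vertexPackingPolytope_of_colorable hχ hcol
  have hp0 : ∀ x, 0 ≤ p x := (K.vertexPackingPolytope_subset_Icc hp).1
  set L := Real.logb 2 (χ : ℝ)
  set Q := blockDist P n
  have hQ : ∀ x, 0 ≤ Q x := hP.blockDist_nonneg n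
  set z : (Fin n → V) → ℝ := fun x => max 0 (Real.logb 2 (1 / b x) - n * (h + η))
  have hent := K.graphEntropy_le hQ (K.midpoint_mem_vertexPackingPolytope hb hp) fun x =>
    add_pos_of_pos_of_nonneg (mul_pos one_half_pos (hbpos x)) (mul_nonneg one_half_pos.le (hp0 x))
  have hpoint : ∀ x, Real.logb 2 (1 / (1 / 2 * b x + 1 / 2 * p x)) ≤
      1 + n * (h + η) + z x + (if x ∈ S then L - n * (h + η) else 0) := by
    intro x
    split_ifs with hx
    · have hinv : 1 / p x = χ := by rw [hpS x hx, one_div, inv_inv]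
      have h1 := Real.logb_one_div_midpoint_le (x := p x) (y := b x)
        (by rw [hpS x hx]; positivity) (hbpos x).le
      rw [hinv] at h1
      rw [add_comm (1 / 2 * b x)]
      have : 0 ≤ z x := le_max_left _ _
      linarith
    · have h1 := Real.logb_one_div_midpoint_le (hbpos x) (hp0 x)
      have : Real.logb 2 (1 / b x) - n * (h + η) ≤ z x := le_max_right _ _
      linarith
  have hsum : ∑ x, Q x * Real.logb 2 (1 / (1 / 2 * b x + 1 / 2 * p x)) ≤
      1 + n * (h + η) + ∑ x, Q x * z x + (∑ x ∈ S, Q x) * (L - n * (h + η)) := by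
    refine (Finset.sum_le_sum fun x _ => mul_le_mul_of_nonneg_left (hpoint x) (hQ x)).trans_eq ?_
    simp_rw [mul_add _ (_ + _) (ite _ _ _), mul_add _ _ (z _), Finset.sum_add_distrib,
      ← Finset.sum_mul]
    rw [hP.sum_blockDist, one_mul, Finset.sum_mul]
    simp [Finset.sum_ite_mem, mul_ite]
  have hμ : 0 < ∑ x ∈ S, Q x := hc.trans_le hS
  have hmain : (∑ x ∈ S, Q x) * (n * h - L) ≤ 3 + 2 * η * n := by
    have : 0 ≤ (∑ x ∈ S, Q x) * (n * η) := by positivity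
    nlinarith
  rw [sub_le_comm, le_div_iff₀ hc]
  by_cases hneg : n * h - L ≤ 0
  · have : 0 ≤ 2 * η * n := by positivity
    nlinarith
  · nlinarith

/-- Achievability: the strings on which `b` costs at most `n (h + 2 ε)` have large probability, and
can be covered greedily by independent sets. -/
theorem IsIrreducibleStationary.minChromaticRate_le (hP : IsIrreducibleStationary P)
    (G : SimpleGraph V) {h ε c : ℝ} {n : ℕ} (hn : 0 < n) (hh : 0 ≤ h) (hε : 0 < ε) (hc : 0 < c)
    {b : (Fin n → V) → ℝ} (hb : b ∈ (G.conormalPow n).vertexPackingPolytope) (hbpos : ∀ x, 0 < b x)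
    (hcost : ∑ x, blockDist P n x * max 0 (Real.logb 2 (1 / b x) - n * (h + ε * (1 - c))) ≤
      ε * (1 - c) * n) :
    minChromaticRate G P c n ≤ h + 2 * ε +
      1 / n * Real.logb 2 (n * (Real.log (Fintype.card V) + 1)) := by
  classical
  have hV := hP.nonempty
  set Q := blockDist P n
  have hQ : ∀ x, 0 ≤ Q x := hP.blockDist_nonneg n
  have hn0 : (0 : ℝ) < n := by exact_mod_cast hn
  have hn1 : (1 : ℝ) ≤ n := by exact_mod_cast hn
  set B : ℝ := n * (h + 2 * ε)
  have hB : 0 ≤ B := by positivity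
  set S : Finset (Fin n → V) := Finset.univ.filter fun x => Real.logb 2 (1 / b x) ≤ B
  have hS : c ≤ ∑ x ∈ S, Q x := by
    have h1 : (∑ x ∈ Finset.univ.filter fun x => ¬ Real.logb 2 (1 / b x) ≤ B, Q x) * (ε * n) ≤
        ε * (1 - c) * n := by
      rw [Finset.sum_mul]
      refine le_trans (Finset.sum_le_sum fun x hx => mul_le_mul_of_nonneg_left ?_ (hQ x))
        ((Finset.sum_le_sum_of_subset_of_nonneg (Finset.filter_subset _ _) fun x _ _ =>
          mul_nonneg (hQ x) (le_max_left _ _)).trans hcost)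
      refine le_trans ?_ (le_max_right _ _)
      have h2 := (Finset.mem_filter.1 hx).2
      have h3 : 0 ≤ n * (ε * c) := by positivity
      simp only [B] at h2
      nlinarith
    have h2 := Finset.sum_filter_add_sum_filter_not Finset.univ
      (fun x => Real.logb 2 (1 / b x) ≤ B) Q
    rw [hP.sum_blockDist] at h2
    have h3 : (∑ x ∈ Finset.univ.filter fun x => ¬ Real.logb 2 (1 / b x) ≤ B, Q x) ≤ 1 - c := by
      refine le_of_mul_le_mul_right (h1.trans_eq ?_) (mul_pos hε hn0)
      ring
    linarith
  set δ : ℝ := 2 ^ (-B)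
  have hδ : 0 < δ := by positivity
  set ℓ := Real.log (Fintype.card V)
  have hℓ : 0 ≤ ℓ := Real.log_natCast_nonneg _
  set M : ℕ := ⌊n * ℓ * 2 ^ B⌋₊ + 1
  have hcol : ((G.conormalPow n).induce (S : Set (Fin n → V))).Colorable M := by
    refine (G.conormalPow n).colorable_induce_of_le hb (δ := δ)
      (Real.rpow_le_one_of_one_le_of_nonpos one_le_two (by linarith)) (fun x hx => ?_) ?_
    · have := (Finset.mem_filter.1 hx).2
      rw [one_div, Real.logb_inv] at this
      rw [← Real.le_logb_iff_rpow_le one_lt_two (hbpos x)]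
      linarith
    · have h1 : Real.log S.card ≤ n * ℓ := by
        rcases S.eq_empty_or_nonempty with h0 | h0
        · simp only [h0, Finset.card_empty, Nat.cast_zero, Real.log_zero]
          positivity
        · have h2 : (S.card : ℝ) ≤ (Fintype.card V : ℝ) ^ n := by
            have := S.card_le_univ
            rw [Fintype.card_fun, Fintype.card_fin] at this
            exact_mod_cast this
          have h3 : (0 : ℝ) < S.card := by exact_mod_cast Finset.card_pos.2 h0
          rw [← Real.log_pow]
          exact Real.log_le_log h3 h2
      have h2 : n * ℓ * 2 ^ B < M := by
        simpa [M] using Nat.lt_floor_add_one (n * ℓ * (2 : ℝ) ^ B)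
      have h3 : δ * (n * ℓ * 2 ^ B) = n * ℓ := by
        have : δ * 2 ^ B = 1 := by
          rw [← Real.rpow_add two_pos, neg_add_cancel, Real.rpow_zero]
        linear_combination (n * ℓ) * this
      exact h1.trans_lt (h3 ▸ mul_lt_mul_of_pos_left h2 hδ)
  have hχ : ((G.conormalPow n).induce (S : Set (Fin n → V))).chromaticNumber.toNat ≤ M :=
    ENat.toNat_le_of_le_natCast hcol.chromaticNumber_le
  have hM1 : (1 : ℝ) ≤ M := by simp [M]
  have hM : (M : ℝ) ≤ 2 ^ B * (n * (ℓ + 1)) := by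
    have h1 : (M : ℝ) ≤ n * ℓ * 2 ^ B + 1 := by
      simpa [M] using Nat.floor_le (a := n * ℓ * (2 : ℝ) ^ B) (by positivity)
    have h2 : (1 : ℝ) ≤ 2 ^ B := Real.one_le_rpow one_le_two hB
    nlinarith
  have hlog : Real.logb 2
      (((G.conormalPow n).induce (S : Set (Fin n → V))).chromaticNumber.toNat : ℝ) ≤
      B + Real.logb 2 (n * (ℓ + 1)) := by
    have h1 : Real.logb 2 (M : ℝ) ≤ B + Real.logb 2 (n * (ℓ + 1)) := by
      have := Real.logb_le_logb_of_le one_lt_two (by linarith) hM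
      rwa [Real.logb_mul (by positivity) (by positivity), Real.logb_rpow two_pos (by norm_num)]
        at this
    refine le_trans ?_ h1
    rcases Nat.eq_zero_or_pos
      ((G.conormalPow n).induce (S : Set (Fin n → V))).chromaticNumber.toNat with h0 | h0
    · rw [h0, Nat.cast_zero, Real.logb_zero]
      exact Real.logb_nonneg one_lt_two hM1
    · exact Real.logb_le_logb_of_le one_lt_two (by exact_mod_cast h0) (by exact_mod_cast hχ)
  refine (ciInf_le (Set.finite_range _).bddBelow ⟨S, hS⟩).trans ?_
  calc _ ≤ 1 / (n : ℝ) * (B + Real.logb 2 (n * (ℓ + 1))) :=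
        mul_le_mul_of_nonneg_left hlog (by positivity)
    _ = _ := by
        simp only [B]
        field_simp

/-- The number of colours lost to the greedy covering is subexponential. -/
theorem tendsto_logb_mul_div {r : ℝ} (hr : r ≠ 0) :
    Tendsto (fun n : ℕ => 1 / (n : ℝ) * Real.logb 2 (n * r)) atTop (𝓝 0) := by
  have h1 : Tendsto (fun n : ℕ => Real.log n / n) atTop (𝓝 0) := by
    simpa [Function.comp_def] using
      (Real.tendsto_pow_log_div_mul_add_atTop 1 0 1 one_ne_zero).comp tendsto_natCast_atTop_atTop
  have h2 := (h1.add (tendsto_const_div_atTop_nhds_zero_nat (Real.log r))).div_const (Real.log 2)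
  simp only [add_zero, zero_div] at h2
  refine h2.congr' ?_
  filter_upwards [eventually_gt_atTop 0] with n hn
  have hn0 : (n : ℝ) ≠ 0 := by exact_mod_cast hn.ne'
  rw [Real.logb, Real.log_mul hn0 hr]
  field_simp

end MarkovSource

theorem mainTheorem3 {V : Type*} [Fintype V] (G : SimpleGraph V) (P : V × V → ℝ)
    (hP : MarkovSource.IsIrreducibleStationary P) :
    ∃ h : ℝ,
      Tendsto (fun n : ℕ => 1 / (n : ℝ) *
        (G.conormalPow n).graphEntropy (MarkovSource.blockDist P n)) atTop (𝓝 h) ∧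
      ∀ c : ℝ, 0 < c → c < 1 →
        Tendsto (fun n : ℕ => MarkovSource.minChromaticRate G P c n) atTop (𝓝 h) := by
  obtain ⟨h, hh, hlower, hupper⟩ := hP.exists_rate G
  refine ⟨h, tendsto_order.2 ⟨fun a ha => ?_, fun a ha => ?_⟩, fun c hc hc1 =>
    tendsto_order.2 ⟨fun a ha => ?_, fun a ha => ?_⟩⟩
  · filter_upwards [eventually_gt_atTop 0, eventually_gt_atTop ⌈2 / (h - a)⌉₊] with n hn hna
    have hn0 : (0 : ℝ) < n := by exact_mod_cast hn
    have h1 := Nat.lt_of_ceil_lt hna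
    rw [div_lt_iff₀ (sub_pos.2 ha)] at h1
    rw [one_div, lt_inv_mul_iff₀ hn0]
    linarith [hlower n hn]
  · filter_upwards [eventually_gt_atTop 0, hupper ((a - h) / 3) (by linarith)]
      with n hn ⟨b, hb, hbpos, hcost⟩
    have hn0 : (0 : ℝ) < n := by exact_mod_cast hn
    have hQ := hP.blockDist_nonneg n
    have h1 := (G.conormalPow n).graphEntropy_le hQ hb hbpos
    have h2 : ∑ x, MarkovSource.blockDist P n x * Real.logb 2 (1 / b x) ≤
        ∑ x, MarkovSource.blockDist P n x *
          (max 0 (Real.logb 2 (1 / b x) - n * (h + (a - h) / 3)) + n * (h + (a - h) / 3)) := by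
      refine Finset.sum_le_sum fun x _ => mul_le_mul_of_nonneg_left ?_ (hQ x)
      linarith [le_max_right 0 (Real.logb 2 (1 / b x) - n * (h + (a - h) / 3))]
    simp_rw [mul_add _ (max _ _), Finset.sum_add_distrib, ← Finset.sum_mul] at h2
    rw [hP.sum_blockDist, one_mul] at h2
    rw [one_div, inv_mul_lt_iff₀ hn0]
    nlinarith
  · -- The slack `h - a` is split between the term `3 / c` and the term `2 η n / c`.
    set η := c * (h - a) / 4 with hη
    have hη0 : 0 < η := by have := sub_pos.2 ha; positivity
    filter_upwards [eventually_gt_atTop 0, eventually_gt_atTop ⌈3 / (2 * η)⌉₊, hupper η hη0]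
      with n hn hna ⟨b, hb, hbpos, hcost⟩
    have hn0 : (0 : ℝ) < n := by exact_mod_cast hn
    have h1 := Nat.lt_of_ceil_lt hna
    rw [div_lt_iff₀ (by positivity)] at h1
    have : Nonempty {S : Finset (Fin n → V) // c ≤ ∑ x ∈ S, MarkovSource.blockDist P n x} :=
      ⟨Finset.univ, by rw [hP.sum_blockDist]; exact hc1.le⟩
    have h2 : (3 + 2 * η * n) / c < (h - a) * n := by
      rw [div_lt_iff₀ hc]
      have : 4 * η = c * (h - a) := by rw [hη]; ring
      nlinarith
    have h3 : a < 1 / n * (n * h - (3 + 2 * η * n) / c) := by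
      rw [one_div, lt_inv_mul_iff₀ hn0]
      linarith
    refine h3.trans_le (le_ciInf fun S => ?_)
    exact mul_le_mul_of_nonneg_left
      (hP.le_logb_chromaticNumber G hc hη0.le (hlower n hn) hb hbpos hcost S.2) (by positivity)
  · set ε := (a - h) / 4 with hε
    have hε0 : 0 < ε := by have := sub_pos.2 ha; positivity
    have hℓ : Real.log (Fintype.card V) + 1 ≠ 0 := by
      have := Real.log_natCast_nonneg (Fintype.card V)
      positivity
    filter_upwards [eventually_gt_atTop 0, hupper (ε * (1 - c)) (mul_pos hε0 (sub_pos.2 hc1)),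
      (tendsto_order.1 (MarkovSource.tendsto_logb_mul_div hℓ)).2 ε hε0]
      with n hn ⟨b, hb, hbpos, hcost⟩ hlog
    have := hP.minChromaticRate_le G hn hh hε0 hc hb hbpos hcost
    linarith
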